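/- Let $\sigma_x,\sigma_y,\sigma_z$ be the Pauli matrices and, for a unit vector $\vec n=(n_x,n_y,n_z)\in\mathbb R^3$ and $\theta\in\mathbb R$, let $R_n(\theta)=e^{-i\sigma_n\theta/2}\in SU(2)$ with $\sigma_n=n_x\sigma_x+n_y\sigma_y+n_z\sigma_z$. An \emph{elementary-gate library} consists of the CNOT gate, finitely many one-parameter subgroups $\{R_n(\theta):\theta\in\mathbb R\}$ of $SU(2)$, and possibly at most countably many further fully specified one-qubit gates from $SU(2)$. A \emph{two-qubit circuit} over the library is a finite sequence of gates, each of which is a CNOT (with either of the two qubits as control and the other one as target) or a one-qubit gate of the library applied to one of the two qubits; a \emph{one-parameter gate} is a gate taken from one of the one-parameter subgroups. A circuit \emph{simulates} $U\in SU(4)$ if the product of its gates equals $U$ up to a global phase. Fix an elementary-gate library. Then there exists $U\in SU(4)$ that cannot be simulated by any two-qubit circuit over the library in which all but at most two of the one-qubit gates appear either before the first or after the last CNOT gate (a circuit without CNOTs counts as such a circuit). Moreover, $U$ can be chosen such that every two-qubit circuit over the library that simulates $U$ contains at least three one-parameter gates that lie between the first and the last CNOT gate. -/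

import Mathlib

open scoped Kronecker

noncomputable section

namespace TwoQubit

/-- The matrix `σ_n = n_x σ_x + n_y σ_y + n_z σ_z` attached to a vector `n` of `ℝ³`. -/
def pauli (n : EuclideanSpace ℝ (Fin 3)) : Matrix (Fin 2) (Fin 2) ℂ :=
  (n 0 : ℂ) • !![0, 1; 1, 0] + (n 1 : ℂ) • !![0, -Complex.I; Complex.I, 0]
    + (n 2 : ℂ) • !![1, 0; 0, -1]

/-- The rotation `R_n(θ) = exp (-i σ_n θ / 2)`. For a unit vector `n`, the set of all `R_n(θ)`,
`θ ∈ ℝ`, is a one-parameter subgroup of `SU(2)`, and every (nontrivial) one-parameter subgroup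
of `SU(2)` arises in this way. -/
def rotation (n : EuclideanSpace ℝ (Fin 3)) (θ : ℝ) : Matrix (Fin 2) (Fin 2) ℂ :=
  NormedSpace.exp ((-(Complex.I * (θ : ℂ) / 2)) • pauli n)

/-- An elementary-gate library. Besides the CNOT gate, it contains finitely many one-parameter
subgroups of `SU(2)`, given by unit vectors as rotation axes, and possibly some fully
specified one-qubit gates, at most countably many. -/
structure ElementaryGateLibrary where
  axes : Set (EuclideanSpace ℝ (Fin 3))
  finite_axes : axes.Finite
  norm_axes : ∀ n ∈ axes, ‖n‖ = 1
  constants : Set (Matrix.specialUnitaryGroup (Fin 2) ℂ)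
  countable_constants : constants.Countable

/-- A gate from the library `L`, placed in a two-qubit circuit. The wires are numbered by
`Fin 2`; a CNOT is given by its control, and its target is the other wire. -/
inductive Gate (L : ElementaryGateLibrary) : Type
  | cnot (control : Fin 2) : Gate L
  | rot (wire : Fin 2) (n : L.axes) (θ : ℝ) : Gate L
  | const (wire : Fin 2) (u : L.constants) : Gate L

/-- The two-qubit operator that applies the one-qubit operator `a` to the given wire. -/
def onWire (wire : Fin 2) (a : Matrix (Fin 2) (Fin 2) ℂ) :
    Matrix (Fin 2 × Fin 2) (Fin 2 × Fin 2) ℂ :=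
  if wire = 0 then a ⊗ₖ 1 else 1 ⊗ₖ a

/-- The CNOT with the given control. In the computational basis it sends `|x, y⟩` to
`|x, y ⊕ x⟩` if the control is wire `0`, and to `|x ⊕ y, y⟩` if the control is wire `1`. -/
def cnotMatrix (control : Fin 2) : Matrix (Fin 2 × Fin 2) (Fin 2 × Fin 2) ℂ :=
  Matrix.of fun p q =>
    if p = (if control = 0 then (q.1, q.2 + q.1) else (q.1 + q.2, q.2)) then 1 else 0

namespace Gate

variable {L : ElementaryGateLibrary}

/-- The operator of a gate. -/
def toMatrix : Gate L → Matrix (Fin 2 × Fin 2) (Fin 2 × Fin 2) ℂ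
  | cnot control => cnotMatrix control
  | rot wire n θ => onWire wire (rotation n θ)
  | const wire u => onWire wire (u : Matrix.specialUnitaryGroup (Fin 2) ℂ)

/-- The gate is a CNOT. -/
def IsCNOT : Gate L → Prop
  | cnot _ => True
  | _ => False

/-- The gate is a gate from one of the one-parameter subgroups. -/
def IsOneParameter : Gate L → Prop
  | rot _ _ _ => True
  | _ => False

/-- The gate is a one-qubit gate. -/
def IsOneQubit (g : Gate L) : Prop := ¬ g.IsCNOT

end Gate

/-- A two-qubit circuit over the library `L`: the list of its gates, in the order in which they
are applied. -/
abbrev Circuit (L : ElementaryGateLibrary) : Type := List (Gate L)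

namespace Circuit

variable {L : ElementaryGateLibrary}

/-- The operator computed by a circuit. -/
def eval : Circuit L → Matrix (Fin 2 × Fin 2) (Fin 2 × Fin 2) ℂ
  | [] => 1
  | g :: c => eval c * g.toMatrix

/-- The circuit simulates the operator `U` up to a global phase. -/
def Simulates (c : Circuit L) (U : Matrix (Fin 2 × Fin 2) (Fin 2 × Fin 2) ℂ) : Prop :=
  ∃ z : ℂ, ‖z‖ = 1 ∧ U = z • eval c

/-- Position `i` lies before all CNOTs of the circuit, that is, before the first one. -/
def BeforeFirstCNOT (c : Circuit L) (i : Fin c.length) : Prop :=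
  ∀ j : Fin c.length, (c.get j).IsCNOT → i < j

/-- Position `i` lies after all CNOTs of the circuit, that is, after the last one. -/
def AfterLastCNOT (c : Circuit L) (i : Fin c.length) : Prop :=
  ∀ j : Fin c.length, (c.get j).IsCNOT → j < i

/-- The positions of the one-qubit gates that appear neither before the first nor after the last
CNOT. (There are none if the circuit has no CNOT.) -/
def middleOneQubit (c : Circuit L) : Set (Fin c.length) :=
  {i | (c.get i).IsOneQubit ∧ ¬ (BeforeFirstCNOT c i ∨ AfterLastCNOT c i)}

/-- The positions of the one-parameter gates that appear neither before the first nor after the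
last CNOT. -/
def middleOneParameter (c : Circuit L) : Set (Fin c.length) :=
  {i | (c.get i).IsOneParameter ∧ ¬ (BeforeFirstCNOT c i ∨ AfterLastCNOT c i)}

end Circuit

end TwoQubit

end

open scoped Kronecker

noncomputable section

namespace TwoQubit

/-! The proof is a dimension count modulo local gates. Determinant-one one-qubit gates preserve the
form `bilin`, so multiplying `U` by them on either side only conjugates `gamma U`; its trace
(complex) and twice its second elementary symmetric function (real for `U ∈ SU(4)`) are three real
local invariants.

Gates before the first or after the last CNOT therefore do not affect `invariant`. If at most two
one-parameter gates lie in between, the invariant lies in a countable union of `C¹` images of `ℝ²`,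
one for each arrangement of gates and each admissible phase. This set has Hausdorff dimension at
most 2 (`dimH_reachable_le`), so its complement is dense in the 3-dimensional space `ℂ × ℝ`. But
invariants of `SU(4)` fill a neighbourhood of `0` (`exists_invariant_eq`), so some `U` has an
unreachable invariant. -/

/-! ### Local operators and the invariant bilinear form. -/

/-- The matrix of the standard symplectic form on `ℂ²`. -/
def eps : Matrix (Fin 2) (Fin 2) ℂ := !![0, 1; -1, 0]

/-- The symmetric bilinear form on `ℂ² ⊗ ℂ²` that is preserved by all local `SL(2)` operators. -/
def bilin : Matrix (Fin 2 × Fin 2) (Fin 2 × Fin 2) ℂ := eps ⊗ₖ eps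

theorem eps_mul_eps : eps * eps = -1 := by
  ext i j; fin_cases i <;> fin_cases j <;> simp [eps]

theorem bilin_mul_bilin : bilin * bilin = 1 := by
  rw [bilin, ← Matrix.mul_kronecker_mul, eps_mul_eps, ← neg_one_smul ℂ (1 : Matrix (Fin 2) (Fin 2) ℂ),
    Matrix.smul_kronecker, Matrix.kronecker_smul, smul_smul, Matrix.one_kronecker_one]
  simp

theorem mul_eps_mul_transpose (A : Matrix (Fin 2) (Fin 2) ℂ) : A * eps * A.transpose = A.det • eps := by
  ext i j
  fin_cases i <;> fin_cases j <;>
    simp [eps, Matrix.mul_apply, Fin.sum_univ_two, Matrix.det_fin_two] <;> ring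

theorem smul_pauli_transpose (a : ℂ) (n : EuclideanSpace ℝ (Fin 3)) :
    (a • pauli n).transpose = eps⁻¹ * (-(a • pauli n)) * eps := by
  have h : eps⁻¹ = -eps := Matrix.inv_eq_right_inv (by rw [mul_neg, eps_mul_eps, neg_neg])
  rw [h]
  ext i j
  fin_cases i <;> fin_cases j <;>
    simp [eps, pauli, Matrix.mul_apply, Fin.sum_univ_two]

theorem isUnit_eps : IsUnit eps :=
  IsUnit.of_mul_eq_one (-eps) (by rw [mul_neg, eps_mul_eps, neg_neg])

/-- The exponent lies in `sl₂ = sp₂`: conjugation by `eps` turns its transpose into its negative.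
Hence its exponential preserves `eps`, which for a 2×2 matrix means determinant 1. -/
theorem det_rotation (n : EuclideanSpace ℝ (Fin 3)) (θ : ℝ) : (rotation n θ).det = 1 := by
  have h : rotation n θ * eps * (rotation n θ).transpose = eps := by
    have hu := (Matrix.isUnit_iff_isUnit_det _).1 isUnit_eps
    have hr := (Matrix.isUnit_iff_isUnit_det _).1
      (Matrix.isUnit_exp ((-(Complex.I * (θ : ℂ) / 2)) • pauli n))
    rw [rotation, ← Matrix.exp_transpose, smul_pauli_transpose, Matrix.exp_conj' _ _ isUnit_eps,
      Matrix.exp_neg, mul_assoc, mul_assoc, Matrix.mul_nonsing_inv_cancel_left _ _ hu,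
      Matrix.mul_nonsing_inv_cancel_left _ _ hr]
  rw [mul_eps_mul_transpose] at h
  simpa [eps] using congrFun (congrFun h 0) 1

/-- `V` preserves the bilinear form `bilin`. -/
def PreservesForm (V : Matrix (Fin 2 × Fin 2) (Fin 2 × Fin 2) ℂ) : Prop :=
  V * bilin * V.transpose = bilin

theorem PreservesForm.one : PreservesForm 1 := by simp [PreservesForm]

theorem PreservesForm.mul {V W : Matrix (Fin 2 × Fin 2) (Fin 2 × Fin 2) ℂ}
    (hV : PreservesForm V) (hW : PreservesForm W) : PreservesForm (V * W) := by
  unfold PreservesForm at *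
  calc V * W * bilin * (V * W).transpose = V * (W * bilin * W.transpose) * V.transpose := by
        simp only [Matrix.transpose_mul, mul_assoc]
    _ = bilin := by rw [hW, hV]

theorem preservesForm_onWire (w : Fin 2) {A : Matrix (Fin 2) (Fin 2) ℂ} (hA : A.det = 1) :
    PreservesForm (onWire w A) := by
  have h1 := mul_eps_mul_transpose A
  rw [hA, one_smul] at h1
  unfold PreservesForm onWire bilin
  split_ifs
  · rw [← Matrix.kroneckerMap_transpose, ← Matrix.mul_kronecker_mul, ← Matrix.mul_kronecker_mul, h1]
    simp
  · rw [← Matrix.kroneckerMap_transpose, ← Matrix.mul_kronecker_mul, ← Matrix.mul_kronecker_mul, h1]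
    simp

theorem det_onWire (w : Fin 2) {A : Matrix (Fin 2) (Fin 2) ℂ} (hA : A.det = 1) :
    (onWire w A).det = 1 := by
  unfold onWire; split_ifs <;> simp [Matrix.det_kronecker, hA]

theorem cnotMatrix_mul_self (w : Fin 2) : cnotMatrix w * cnotMatrix w = 1 := by
  ext ⟨i, j⟩ ⟨k, l⟩
  fin_cases w <;> fin_cases i <;> fin_cases j <;> fin_cases k <;> fin_cases l <;>
    simp [cnotMatrix, Matrix.mul_apply]

/-! ### Local invariants. -/

/-- The matrix whose spectrum classifies two-qubit operators up to local operators. -/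
def gamma (U : Matrix (Fin 2 × Fin 2) (Fin 2 × Fin 2) ℂ) : Matrix (Fin 2 × Fin 2) (Fin 2 × Fin 2) ℂ :=
  U * bilin * U.transpose * bilin

/-- Three real invariants of two-qubit operators under local operators. -/
def invariant (U : Matrix (Fin 2 × Fin 2) (Fin 2 × Fin 2) ℂ) : ℂ × ℝ :=
  ((gamma U).trace, ((gamma U).trace ^ 2 - (gamma U * gamma U).trace).re)

theorem gamma_mul_mul {V W : Matrix (Fin 2 × Fin 2) (Fin 2 × Fin 2) ℂ}
    (hV : PreservesForm V) (hW : PreservesForm W) (M : Matrix (Fin 2 × Fin 2) (Fin 2 × Fin 2) ℂ) :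
    ∃ V', V' * V = 1 ∧ gamma (V * M * W) = V * gamma M * V' := by
  unfold PreservesForm at hV hW
  -- Since `bilin` squares to 1, preserving the form makes this the inverse of `V`.
  refine ⟨bilin * V.transpose * bilin, ?_, ?_⟩
  · apply mul_eq_one_comm.1
    calc V * (bilin * V.transpose * bilin) = V * bilin * V.transpose * bilin := by
          simp only [mul_assoc]
      _ = 1 := by rw [hV, bilin_mul_bilin]
  · calc gamma (V * M * W)
        = V * M * (W * bilin * W.transpose) * M.transpose * V.transpose * bilin := by
          simp only [gamma, Matrix.transpose_mul, mul_assoc]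
      _ = V * M * bilin * M.transpose * 1 * V.transpose * bilin := by rw [hW, mul_one]
      _ = V * gamma M * (bilin * V.transpose * bilin) := by
          rw [← bilin_mul_bilin]; simp only [gamma, mul_assoc]

theorem invariant_mul_mul {V W : Matrix (Fin 2 × Fin 2) (Fin 2 × Fin 2) ℂ}
    (hV : PreservesForm V) (hW : PreservesForm W) (M : Matrix (Fin 2 × Fin 2) (Fin 2 × Fin 2) ℂ) :
    invariant (V * M * W) = invariant M := by
  obtain ⟨V', h1, h2⟩ := gamma_mul_mul hV hW M
  have h3 : (gamma (V * M * W)).trace = (gamma M).trace := by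
    rw [h2, Matrix.trace_mul_comm, ← mul_assoc, h1, one_mul]
  have h4 : (gamma (V * M * W) * gamma (V * M * W)).trace = (gamma M * gamma M).trace := by
    have : V * gamma M * V' * (V * gamma M * V') = V * (gamma M * (V' * V) * gamma M) * V' := by
      simp only [mul_assoc]
    rw [h2, this, h1, mul_one, Matrix.trace_mul_comm, ← mul_assoc, h1, one_mul]
  rw [invariant, h3, h4, invariant]

/-! ### A three-parameter family whose invariants fill an open set. -/

/-- A two-qubit operator built from its two blocks on the even and the odd parity subspace. -/
def canonical (e f : ℂ) (a b c d : ℝ) : Matrix (Fin 2 × Fin 2) (Fin 2 × Fin 2) ℂ :=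
  Matrix.of fun p q =>
    if p.1 = p.2 then
      if q.1 = q.2 then if p.1 = q.1 then e * a else Complex.I * e * b else 0
    else
      if q.1 = q.2 then 0 else if p.1 = q.1 then f * c else Complex.I * f * d

theorem invariant_canonical (e f : ℂ) (a b c d : ℝ) :
    invariant (canonical e f a b c d) =
      (2 * e ^ 2 * (a ^ 2 - b ^ 2) + 2 * f ^ 2 * (c ^ 2 - d ^ 2),
        (8 * (e * f) ^ 2 * (a ^ 2 - b ^ 2) * (c ^ 2 - d ^ 2)
          + 2 * e ^ 4 * (a ^ 2 + b ^ 2) ^ 2 + 2 * f ^ 4 * (c ^ 2 + d ^ 2) ^ 2).re) := by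
  have hI := Complex.I_sq
  have hb : bilin = Matrix.of fun p q =>
      if p.1 ≠ q.1 ∧ p.2 ≠ q.2 then if p.1 = p.2 then 1 else -1 else 0 := by
    ext ⟨i, j⟩ ⟨k, l⟩
    fin_cases i <;> fin_cases j <;> fin_cases k <;> fin_cases l <;> simp [bilin, eps]
  have hg : gamma (canonical e f a b c d) = Matrix.of fun p q =>
    if p.1 = p.2 then
      if q.1 = q.2 then if p.1 = q.1 then e ^ 2 * (a ^ 2 - b ^ 2) else 2 * Complex.I * e ^ 2 * a * b
      else 0
    else
      if q.1 = q.2 then 0 else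
        if p.1 = q.1 then f ^ 2 * (c ^ 2 - d ^ 2) else 2 * Complex.I * f ^ 2 * c * d := by
    rw [gamma, hb]
    ext ⟨i, j⟩ ⟨k, l⟩
    fin_cases i <;> fin_cases j <;> fin_cases k <;> fin_cases l <;>
      simp [canonical, Matrix.mul_apply, Fintype.sum_prod_type, Fin.sum_univ_two] <;> grind
  rw [invariant, hg]
  refine congrArg₂ (fun (x y : ℂ) => (x, y.re)) ?_ ?_ <;>
    simp [Matrix.trace, Matrix.mul_apply, Fintype.sum_prod_type, Fin.sum_univ_two] <;> grind

theorem canonical_mem {e f : ℂ} {a b c d : ℝ} (hef : e * f = 1) (he : star e = f)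
    (hab : a ^ 2 + b ^ 2 = 1) (hcd : c ^ 2 + d ^ 2 = 1) :
    canonical e f a b c d ∈ Matrix.specialUnitaryGroup (Fin 2 × Fin 2) ℂ := by
  have hI := Complex.I_sq
  have hf : star f = e := by rw [← he, star_star]
  have hab' : (a : ℂ) ^ 2 + (b : ℂ) ^ 2 = 1 := by exact_mod_cast hab
  have hcd' : (c : ℂ) ^ 2 + (d : ℂ) ^ 2 = 1 := by exact_mod_cast hcd
  simp only [Complex.star_def] at he hf
  rw [Matrix.mem_specialUnitaryGroup_iff, Matrix.mem_unitaryGroup_iff]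
  constructor
  · ext ⟨i, j⟩ ⟨k, l⟩
    fin_cases i <;> fin_cases j <;> fin_cases k <;> fin_cases l <;>
      simp [canonical, Matrix.mul_apply, Fintype.sum_prod_type, Fin.sum_univ_two, he, hf] <;> grind
  -- Reindexing by `Fin 4` makes Laplace expansion available.
  · rw [← Matrix.det_submatrix_equiv_self (finProdFinEquiv (m := 2) (n := 2)).symm]
    have : (canonical e f a b c d).submatrix (finProdFinEquiv (m := 2) (n := 2)).symm
        (finProdFinEquiv (m := 2) (n := 2)).symm =
        !![e * a, 0, 0, Complex.I * e * b; 0, f * c, Complex.I * f * d, 0;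
          0, Complex.I * f * d, f * c, 0; Complex.I * e * b, 0, 0, e * a] := by
      ext i j
      fin_cases i <;> fin_cases j <;>
        simp [canonical, finProdFinEquiv, Fin.divNat, Fin.modNat]
    rw [this]
    simp [Matrix.det_succ_row_zero, Fin.sum_univ_succ, Fin.succAbove]
    grind

/-- Put `u = C²`. The first two equations give `P + Q = x / C` and `P - Q = y / S`, so `4PQ = x²/u -
y²/(1-u)`. The third becomes one equation in `u`, solved by the intermediate value theorem on `[1/4,
3/4]`, where `C` and `S` stay away from 0. -/
theorem exists_parameters {x y t : ℝ} (hx : |x| < 1 / 10) (hy : |y| < 1 / 10)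
    (ht : |t - 1 / 2| < 1 / 10) :
    ∃ C S P Q : ℝ, C ^ 2 + S ^ 2 = 1 ∧ |P| ≤ 1 ∧ |Q| ≤ 1 ∧
      C * (P + Q) = x ∧ S * (P - Q) = y ∧ P * Q + C ^ 2 = t := by
  rw [abs_lt] at hx hy ht
  have hx2 : x ^ 2 ≤ 1 / 100 := by nlinarith
  have hy2 : y ^ 2 ≤ 1 / 100 := by nlinarith
  have hc : ContinuousOn (fun u : ℝ => x ^ 2 / u - y ^ 2 / (1 - u) - 4 * t + 4 * u)
      (Set.Icc (1 / 4) (3 / 4)) := by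
    refine ((ContinuousOn.sub ?_ ?_).sub continuousOn_const).add (by fun_prop)
    · exact continuousOn_const.div continuousOn_id fun u hu => by
        have := hu.1; exact (by linarith : (0 : ℝ) < u).ne'
    · exact continuousOn_const.div (by fun_prop) fun u hu => by
        have := hu.2; exact (by linarith : (0 : ℝ) < 1 - u).ne'
  obtain ⟨u, ⟨hu1, hu2⟩, hu⟩ := intermediate_value_Icc (by norm_num) hc
    (show (0 : ℝ) ∈ Set.Icc _ _ by
      constructor <;> norm_num <;> nlinarith [sq_nonneg x, sq_nonneg y])
  simp only at hu
  have hu0 : 0 < u := by linarith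
  have hv0 : 0 < 1 - u := by linarith
  have hC := Real.sq_sqrt hu0.le
  have hS := Real.sq_sqrt hv0.le
  have hC' : 1 / 2 ≤ √u := Real.le_sqrt_of_sq_le (by linarith)
  have hS' : 1 / 2 ≤ √(1 - u) := Real.le_sqrt_of_sq_le (by linarith)
  have hxb : |x / √u| ≤ 1 := by
    rw [abs_div, abs_of_pos (by linarith : 0 < √u), div_le_one (by linarith)]
    exact (abs_le.2 ⟨by linarith, by linarith⟩)
  have hyb : |y / √(1 - u)| ≤ 1 := by
    rw [abs_div, abs_of_pos (by linarith : 0 < √(1 - u)), div_le_one (by linarith)]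
    exact (abs_le.2 ⟨by linarith, by linarith⟩)
  rw [abs_le] at hxb hyb
  refine ⟨√u, √(1 - u), (x / √u + y / √(1 - u)) / 2, (x / √u - y / √(1 - u)) / 2, by linarith,
    abs_le.2 ⟨by linarith, by linarith⟩, abs_le.2 ⟨by linarith, by linarith⟩, ?_, ?_, ?_⟩
  · field_simp; ring
  · field_simp; ring
  · have h1 : (x / √u) ^ 2 = x ^ 2 / u := by rw [div_pow, hC]
    have h2 : (y / √(1 - u)) ^ 2 = y ^ 2 / (1 - u) := by rw [div_pow, hS]
    linarith

theorem exists_sq_sub_sq {P : ℝ} (hP : |P| ≤ 1) : ∃ a b : ℝ, a ^ 2 + b ^ 2 = 1 ∧ a ^ 2 - b ^ 2 = P := by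
  rw [abs_le] at hP
  refine ⟨√((1 + P) / 2), √((1 - P) / 2), ?_, ?_⟩ <;>
    rw [Real.sq_sqrt (by linarith), Real.sq_sqrt (by linarith)] <;> ring

/-! ### Circuits as smooth functions of their angles. -/

section
attribute [local instance] Matrix.linftyOpNormedRing Matrix.linftyOpNormedAlgebra

theorem contDiff_rotation (n : EuclideanSpace ℝ (Fin 3)) (i j : Fin 2) :
    ContDiff ℝ 1 fun θ => rotation n θ i j := by
  have h : ContDiff ℝ 1 (NormedSpace.exp : Matrix (Fin 2) (Fin 2) ℂ → Matrix (Fin 2) (Fin 2) ℂ) :=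
    contDiff_iff_contDiffAt.2 fun x => 
      (NormedSpace.exp_analytic (𝕂 := ℝ) (𝔸 := Matrix (Fin 2) (Fin 2) ℂ) x).contDiffAt
  have h2 : ContDiff ℝ 1 fun θ : ℝ => (-(Complex.I * (θ : ℂ) / 2)) • pauli n := by
    have h0 : ContDiff ℝ 1 fun θ : ℝ => (θ : ℂ) := Complex.ofRealCLM.contDiff
    exact (LinearMap.toContinuousLinearMap
      ((LinearMap.toSpanSingleton ℂ _ (pauli n)).restrictScalars ℝ)).contDiff.comp
      ((contDiff_const.mul h0).div_const 2).neg
  have h3 : ContDiff ℝ 1 fun A : Matrix (Fin 2) (Fin 2) ℂ => A i j :=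
    (LinearMap.toContinuousLinearMap (Matrix.entryLinearMap ℝ ℂ i j)).contDiff
  exact h3.comp (h.comp h2)

end

variable (L : ElementaryGateLibrary)

/-- Gates of a circuit with unspecified angles: a one-parameter gate refers to one of `m`
parameters. -/
abbrev GateShape (m : ℕ) : Type := Fin 2 ⊕ (Fin 2 × L.axes × Fin m) ⊕ (Fin 2 × L.constants)

instance (m : ℕ) : Countable (GateShape L m) := by
  have := L.finite_axes.to_subtype
  have := L.countable_constants.to_subtype
  infer_instance

variable {L}

/-- The operator of a gate with unspecified angles at given parameters. -/
def GateShape.toMatrix {m : ℕ} (θ : Fin m → ℝ) :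
    GateShape L m → Matrix (Fin 2 × Fin 2) (Fin 2 × Fin 2) ℂ
  | .inl w => cnotMatrix w
  | .inr (.inl (w, n, i)) => onWire w (rotation n (θ i))
  | .inr (.inr (w, u)) => onWire w (u : Matrix.specialUnitaryGroup (Fin 2) ℂ)

/-- The operator of a circuit with unspecified angles at given parameters. -/
def shapeEval {m : ℕ} (θ : Fin m → ℝ) :
    List (GateShape L m) → Matrix (Fin 2 × Fin 2) (Fin 2 × Fin 2) ℂ
  | [] => 1
  | g :: s => shapeEval θ s * g.toMatrix θ

theorem contDiff_onWire {E : Type*} [NormedAddCommGroup E] [NormedSpace ℝ E] (w : Fin 2)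
    {A : E → Matrix (Fin 2) (Fin 2) ℂ} (hA : ∀ i j, ContDiff ℝ 1 fun x => A x i j)
    (p q : Fin 2 × Fin 2) : ContDiff ℝ 1 fun x => onWire w (A x) p q := by
  unfold onWire
  split_ifs
  · simpa [Matrix.kroneckerMap_apply] using (hA _ _).mul contDiff_const
  · simpa [Matrix.kroneckerMap_apply] using contDiff_const.mul (hA _ _)

theorem contDiff_matrix_mul {E ι : Type*} [NormedAddCommGroup E] [NormedSpace ℝ E] [Fintype ι]
    {A B : E → Matrix ι ι ℂ} (hA : ∀ i j, ContDiff ℝ 1 fun x => A x i j)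
    (hB : ∀ i j, ContDiff ℝ 1 fun x => B x i j) (i j : ι) :
    ContDiff ℝ 1 fun x => (A x * B x) i j := by
  simp only [Matrix.mul_apply]
  exact ContDiff.sum fun k _ => (hA i k).mul (hB k j)

theorem GateShape.contDiff_toMatrix {m : ℕ} (g : GateShape L m) (p q : Fin 2 × Fin 2) :
    ContDiff ℝ 1 fun θ : Fin m → ℝ => g.toMatrix θ p q := by
  rcases g with w | ⟨w, n, i⟩ | ⟨w, u⟩
  · exact contDiff_const
  · exact contDiff_onWire w (fun a b => (contDiff_rotation n a b).comp (contDiff_apply ℝ ℝ i)) p q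
  · exact contDiff_const

theorem contDiff_shapeEval {m : ℕ} (s : List (GateShape L m)) (p q : Fin 2 × Fin 2) :
    ContDiff ℝ 1 fun θ : Fin m → ℝ => shapeEval θ s p q := by
  induction s generalizing p q with
  | nil => exact contDiff_const
  | cons g s ih => exact contDiff_matrix_mul ih g.contDiff_toMatrix p q

/-- Shift the parameters of a gate by one. -/
def GateShape.shift {m : ℕ} : GateShape L m → GateShape L (m + 1) :=
  Sum.map id (Sum.map (Prod.map id (Prod.map id Fin.succ)) id)

theorem shapeEval_shift {m : ℕ} (t : ℝ) (θ : Fin m → ℝ) (s : List (GateShape L m)) :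
    shapeEval (Fin.cons t θ : Fin (m + 1) → ℝ) (s.map GateShape.shift) = shapeEval θ s := by
  induction s with
  | nil => rfl
  | cons g s ih =>
    rw [List.map_cons, shapeEval, shapeEval, ih]
    rcases g with w | ⟨w, n, i⟩ | ⟨w, u⟩ <;> rfl

theorem Gate.isOneParameter_cnot (w : Fin 2) : ¬ (Gate.cnot w : Gate L).IsOneParameter := id

theorem Gate.isOneParameter_const (w : Fin 2) (u : L.constants) :
    ¬ (Gate.const w u).IsOneParameter := id

theorem Gate.isOneParameter_rot (w : Fin 2) (n : L.axes) (θ : ℝ) :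
    (Gate.rot w n θ).IsOneParameter := trivial

open Classical in
theorem exists_shapeEval (c : Circuit L) (m : ℕ) (h : c.countP (fun g => g.IsOneParameter) ≤ m) :
    ∃ (s : List (GateShape L m)) (θ : Fin m → ℝ), c.eval = shapeEval θ s := by
  induction c generalizing m with
  | nil => exact ⟨[], 0, rfl⟩
  | cons g c ih =>
    cases g with
    | cnot w =>
      obtain ⟨s, θ, e⟩ := ih m (by simpa [Gate.isOneParameter_cnot] using h)
      exact ⟨.inl w :: s, θ, by rw [Circuit.eval, e]; rfl⟩
    | const w u =>
      obtain ⟨s, θ, e⟩ := ih m (by simpa [Gate.isOneParameter_const] using h)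
      exact ⟨.inr (.inr (w, u)) :: s, θ, by rw [Circuit.eval, e]; rfl⟩
    | rot w n t =>
      obtain _ | m := m
      · simp [Gate.isOneParameter_rot] at h
      obtain ⟨s, θ, e⟩ := ih m (by simpa [Gate.isOneParameter_rot] using h)
      -- The new angle takes index 0; the others move up by one.
      refine ⟨.inr (.inl (w, n, 0)) :: s.map GateShape.shift, Fin.cons t θ, ?_⟩
      rw [Circuit.eval, e, shapeEval, shapeEval_shift]
      rfl

/-! ### Splitting off the outer one-qubit gates. -/

theorem Circuit.eval_append (c d : Circuit L) : Circuit.eval (c ++ d) = d.eval * c.eval := by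
  induction c with
  | nil => simp [Circuit.eval]
  | cons g c ih => rw [List.cons_append, Circuit.eval, ih, Circuit.eval, mul_assoc]

theorem countP_le_ncard {α : Type*} (p : α → Bool) (l : List α) :
    l.countP p ≤ {i : Fin l.length | p (l.get i)}.ncard := by
  have : l.countP p = Fintype.card {i : Fin l.length // p (l.get i)} := by
    conv_lhs => rw [← List.map_get_finRange l, List.countP_map]
    rw [Fintype.card_subtype, ← List.toFinset_finRange,
      (List.nodup_finRange l.length).card_eq_countP]
    simp [Function.comp_def]
  rw [this, ← Nat.card_eq_fintype_card]; rfl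

-- Strip the longest prefix and then the longest suffix of one-qubit gates. What remains is empty or
-- begins and ends with a CNOT, so its one-parameter gates are all middle ones.
open Classical in
theorem Circuit.exists_decomposition (d : Circuit L) : ∃ pre mid post : Circuit L,
    d = pre ++ mid ++ post ∧ (∀ g ∈ pre, g.IsOneQubit) ∧ (∀ g ∈ post, g.IsOneQubit) ∧
      mid.countP (fun g => g.IsOneParameter) ≤ (Circuit.middleOneParameter d).ncard := by
  let p : Gate L → Bool := fun g => g.IsOneQubit
  set pre := d.takeWhile p with hpre
  set mid := (d.dropWhile p).rdropWhile p with hmid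
  set post := (d.dropWhile p).rtakeWhile p with hpost
  have hc : d = pre ++ mid ++ post := by
    rw [hpre, hmid, hpost, List.append_assoc, List.rdropWhile_append_rtakeWhile,
      List.takeWhile_append_dropWhile]
  refine ⟨pre, mid, post, hc, ?_, ?_, ?_⟩
  · intro g hg
    simpa [p] using List.mem_takeWhile_imp hg
  · intro g hg
    simpa [p] using List.mem_rtakeWhile_imp hg
  · refine (countP_le_ncard _ _).trans ?_
    have hlen : ∀ i : Fin mid.length, pre.length + i < d.length := by
      intro i
      have := congrArg List.length hc
      simp only [List.length_append] at this
      have := i.2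
      omega
    have hget : ∀ i : Fin mid.length, d.get ⟨pre.length + i, hlen i⟩ = mid.get i := by
      intro i
      have h1 : d[pre.length + (i : ℕ)]? = mid[(i : ℕ)]? := by
        rw [hc, List.append_assoc, List.getElem?_append_right (by omega),
          List.getElem?_append_left (by have := i.2; omega)]
        simp
      have h2 := hlen i
      simpa [List.getElem?_eq_getElem h2, List.getElem?_eq_getElem i.2] using h1
    have hne : ∀ i : Fin mid.length, mid ≠ [] := fun i h => by
      have := i.2; simp [h] at this
    have hfirst : ∀ h : 0 < mid.length, (mid.get ⟨0, h⟩).IsCNOT := by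
      intro h
      have hd : 0 < (d.dropWhile p).length :=
        h.trans_le (List.rdropWhile_prefix p _).length_le
      have h1 := List.dropWhile_get_zero_not p d hd
      have h2 : mid.get ⟨0, h⟩ = (d.dropWhile p).get ⟨0, hd⟩ := by
        simpa using (List.rdropWhile_prefix p (d.dropWhile p)).getElem h
      rw [h2]
      exact not_not.1 fun h' => h1 (decide_eq_true h')
    have hlast : ∀ h : 0 < mid.length, (mid.get ⟨mid.length - 1, by omega⟩).IsCNOT := by
      intro h
      have h1 := List.rdropWhile_last_not p (d.dropWhile p) (List.ne_nil_of_length_pos h)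
      rw [List.getLast_eq_getElem] at h1
      exact not_not.1 fun h' => h1 (decide_eq_true h')
    refine Set.ncard_le_ncard_of_injOn (fun i => ⟨pre.length + i, hlen i⟩) ?_ ?_ (Set.toFinite _)
    · intro i hi
      have h0 : 0 < mid.length := by have := i.2; omega
      refine ⟨?_, ?_⟩
      · show (d.get ⟨pre.length + i, hlen i⟩).IsOneParameter
        rw [hget]; exact of_decide_eq_true hi
      · rintro (hb | ha)
        · have := hb ⟨pre.length + (⟨0, h0⟩ : Fin mid.length), hlen ⟨0, h0⟩⟩
            (by rw [hget]; exact hfirst h0)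
          simp [Fin.lt_def] at this
        · have := ha ⟨pre.length + (⟨mid.length - 1, by omega⟩ : Fin mid.length), hlen _⟩
            (by rw [hget]; exact hlast h0)
          simp only [Fin.lt_def] at this
          have := i.2
          omega
    · intro i _ j _ h
      simp only [Fin.mk.injEq] at h
      exact Fin.ext (by omega)

/-! ### Dimension count. -/

theorem contDiff_trace {E : Type*} [NormedAddCommGroup E] [NormedSpace ℝ E]
    {A : E → Matrix (Fin 2 × Fin 2) (Fin 2 × Fin 2) ℂ} (hA : ∀ i j, ContDiff ℝ 1 fun x => A x i j) :
    ContDiff ℝ 1 fun x => (A x).trace :=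
  ContDiff.sum fun i _ => hA i i

theorem contDiff_invariant {E : Type*} [NormedAddCommGroup E] [NormedSpace ℝ E]
    {A : E → Matrix (Fin 2 × Fin 2) (Fin 2 × Fin 2) ℂ} (hA : ∀ i j, ContDiff ℝ 1 fun x => A x i j) :
    ContDiff ℝ 1 fun x => invariant (A x) := by
  have hg : ∀ i j, ContDiff ℝ 1 fun x => gamma (A x) i j :=
    contDiff_matrix_mul (contDiff_matrix_mul (contDiff_matrix_mul hA fun _ _ => contDiff_const)
      fun i j => hA j i) fun _ _ => contDiff_const
  have ht := contDiff_trace hg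
  have h2 := contDiff_trace (contDiff_matrix_mul hg hg)
  exact ht.prodMk (Complex.reCLM.contDiff.comp ((ht.pow 2).sub h2))

theorem Gate.preservesForm {g : Gate L} (hg : g.IsOneQubit) : PreservesForm g.toMatrix := by
  cases g with
  | cnot w => exact absurd trivial hg
  | rot w n θ => exact preservesForm_onWire w (det_rotation n θ)
  | const w u =>
    exact preservesForm_onWire w (Matrix.mem_specialUnitaryGroup_iff.1 (u : Matrix.specialUnitaryGroup (Fin 2) ℂ).2).2

theorem Circuit.preservesForm {c : Circuit L} (hc : ∀ g ∈ c, g.IsOneQubit) :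
    PreservesForm c.eval := by
  induction c with
  | nil => exact PreservesForm.one
  | cons g c ih =>
    exact (ih fun g' h => hc g' (List.mem_cons_of_mem _ h)).mul
      (Gate.preservesForm (hc g List.mem_cons_self))

theorem Gate.det_sq (g : Gate L) : g.toMatrix.det ^ 2 = 1 := by
  cases g with
  | cnot w => rw [pow_two, ← Matrix.det_mul]; exact (congrArg _ (cnotMatrix_mul_self w)).trans Matrix.det_one
  | rot w n θ => rw [show (Gate.rot w n θ).toMatrix.det = 1 from det_onWire w (det_rotation n θ), one_pow]
  | const w u =>
    rw [show (Gate.const w u).toMatrix.det = 1 from det_onWire w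
      (Matrix.mem_specialUnitaryGroup_iff.1 (u : Matrix.specialUnitaryGroup (Fin 2) ℂ).2).2, one_pow]

/-- With `det U = 1` this forces the global phase to be an eighth root of unity; a continuous phase
would count as a third real parameter. -/
theorem Circuit.det_sq (c : Circuit L) : c.eval.det ^ 2 = 1 := by
  induction c with
  | nil => simp [Circuit.eval]
  | cons g c ih => rw [Circuit.eval, Matrix.det_mul, mul_pow, ih, g.det_sq, one_mul]

variable (L) in
/-- The values of `invariant` at the operators of determinant one that are simulated by circuits
with at most two one-parameter gates between the first and the last CNOT. -/
def reachable : Set (ℂ × ℝ) :=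
  ⋃ (z : {z : ℂ | z ^ 8 = 1}) (s : List (GateShape L 2)),
    Set.range fun θ : Fin 2 → ℝ => invariant ((z : ℂ) • shapeEval θ s)

theorem dimH_reachable_le : dimH (reachable L) ≤ 2 := by
  have : Finite {z : ℂ | z ^ 8 = 1} := by
    have h : (Polynomial.X ^ 8 - 1 : Polynomial ℂ) ≠ 0 := Polynomial.X_pow_sub_C_ne_zero (by norm_num) 1
    refine ((Polynomial.finite_setOfPred_isRoot h).subset fun z hz => ?_).to_subtype
    have hz : z ^ 8 = 1 := hz
    simp [hz]
  rw [reachable, dimH_iUnion]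
  refine iSup_le fun z => ?_
  rw [dimH_iUnion]
  refine iSup_le fun s => ?_
  have h := ContDiff.dimH_range_le (contDiff_invariant (A := fun θ => (z : ℂ) • shapeEval θ s)
    fun i j => contDiff_const.mul (contDiff_shapeEval s i j))
  simpa using h

theorem invariant_mem_reachable {U : Matrix (Fin 2 × Fin 2) (Fin 2 × Fin 2) ℂ} (hU : U.det = 1)
    {c : Circuit L} (hc : c.Simulates U) (h : (Circuit.middleOneParameter c).ncard ≤ 2) :
    invariant U ∈ reachable L := by
  obtain ⟨z, -, hz⟩ := hc
  obtain ⟨pre, mid, post, rfl, hpre, hpost, hmid⟩ := Circuit.exists_decomposition c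
  obtain ⟨s, θ, hs⟩ := exists_shapeEval mid 2 (hmid.trans h)
  have hz8 : z ^ 8 = 1 := by
    have h1 := Circuit.det_sq (pre ++ mid ++ post)
    rw [hz, Matrix.det_smul] at hU
    have h2 : z ^ 8 * (Circuit.eval (pre ++ mid ++ post)).det ^ 2 = 1 := by
      have := congrArg (· ^ 2) hU
      simp only [Fintype.card_prod, Fintype.card_fin, mul_pow, one_pow, ← pow_mul] at this
      exact this
    rwa [h1, mul_one] at h2
  have hV : U = Circuit.eval post * (z • shapeEval θ s) * Circuit.eval pre := by
    rw [hz, Circuit.eval_append, Circuit.eval_append, hs, mul_smul_comm, smul_mul_assoc, mul_assoc]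
  rw [hV, invariant_mul_mul (Circuit.preservesForm hpost) (Circuit.preservesForm hpre)]
  exact Set.mem_iUnion₂.2 ⟨⟨z, hz8⟩, s, θ, rfl⟩

theorem exists_invariant_eq {v : ℂ × ℝ} (hx : |v.1.re / 2| < 1 / 10) (hy : |v.1.im / 2| < 1 / 10)
    (ht : |(v.2 + 4) / 8 - 1 / 2| < 1 / 10) :
    ∃ U ∈ Matrix.specialUnitaryGroup (Fin 2 × Fin 2) ℂ, invariant U = v := by
  obtain ⟨C, S, P, Q, hCS, hP, hQ, h1, h2, h3⟩ := exists_parameters hx hy ht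
  obtain ⟨a, b, hab, habP⟩ := exists_sq_sub_sq hP
  obtain ⟨c, d, hcd, hcdQ⟩ := exists_sq_sub_sq hQ
  -- With `e² = C + iS` and `f = star e`, the invariant is `(2C(P+Q) + 2iS(P-Q), 8PQ + 8C² - 4)`,
  -- hence the rescaling of `v` in the hypotheses.
  obtain ⟨e, he⟩ := IsAlgClosed.exists_pow_nat_eq (⟨C, S⟩ : ℂ) two_pos
  have hne : Complex.normSq e = 1 := by
    have h4 : Complex.normSq e ^ 2 = 1 := by
      rw [← map_pow, he, Complex.normSq_mk]; linarith
    nlinarith [Complex.normSq_nonneg e]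
  have hef : e * star e = 1 := by
    rw [Complex.star_def, Complex.mul_conj, hne, Complex.ofReal_one]
  have hf : star e ^ 2 = (⟨C, -S⟩ : ℂ) := by
    rw [← star_pow, he]; rfl
  refine ⟨canonical e (star e) a b c d, canonical_mem hef rfl hab hcd, ?_⟩
  have hab' : (a : ℂ) ^ 2 + (b : ℂ) ^ 2 = 1 := by exact_mod_cast hab
  have hcd' : (c : ℂ) ^ 2 + (d : ℂ) ^ 2 = 1 := by exact_mod_cast hcd
  have habP' : (a : ℂ) ^ 2 - (b : ℂ) ^ 2 = P := by exact_mod_cast habP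
  have hcdQ' : (c : ℂ) ^ 2 - (d : ℂ) ^ 2 = Q := by exact_mod_cast hcdQ
  have h4 : ∀ x : ℂ, x ^ 4 = x ^ 2 * x ^ 2 := fun x => by ring
  rw [invariant_canonical, hef, hab', hcd', habP', hcdQ', h4, h4, he, hf]
  refine Prod.ext (Complex.ext ?_ ?_) ?_
  · simp; linarith
  · simp; linarith
  · simp; linarith

theorem exists_not_mem_reachable (L : ElementaryGateLibrary) :
    ∃ U ∈ Matrix.specialUnitaryGroup (Fin 2 × Fin 2) ℂ, invariant U ∉ reachable L := by
  have hd : Dense (reachable L)ᶜ := by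
    refine dense_compl_of_dimH_lt_finrank (dimH_reachable_le.trans_lt ?_)
    rw [Module.finrank_prod, Complex.finrank_real_complex, Module.finrank_self]
    norm_num
  have h1 : IsOpen {v : ℂ × ℝ | |v.1.re / 2| < 1 / 10} :=
    isOpen_lt (((Complex.continuous_re.comp continuous_fst).div_const 2).abs) continuous_const
  have h2 : IsOpen {v : ℂ × ℝ | |v.1.im / 2| < 1 / 10} :=
    isOpen_lt (((Complex.continuous_im.comp continuous_fst).div_const 2).abs) continuous_const
  have h3 : IsOpen {v : ℂ × ℝ | |(v.2 + 4) / 8 - 1 / 2| < 1 / 10} :=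
    isOpen_lt (by fun_prop) continuous_const
  obtain ⟨v, ⟨hx, hy, ht⟩, hv⟩ := hd.inter_open_nonempty
    {v : ℂ × ℝ | |v.1.re / 2| < 1 / 10 ∧ |v.1.im / 2| < 1 / 10 ∧ |(v.2 + 4) / 8 - 1 / 2| < 1 / 10}
    -- The box is centred at `v = 0`, where `x = y = 0` and `t = 1/2`.
    (h1.and (h2.and h3)) ⟨0, by norm_num⟩
  obtain ⟨U, hU, rfl⟩ := exists_invariant_eq hx hy ht
  exact ⟨U, hU, hv⟩

theorem Circuit.ncard_middleOneParameter_le (c : Circuit L) :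
    (middleOneParameter c).ncard ≤ (middleOneQubit c).ncard := by
  refine Set.ncard_le_ncard (fun i hi => ⟨fun h => ?_, hi.2⟩) (Set.toFinite _)
  have h1 := hi.1
  revert h h1
  cases List.get c i with
  | cnot w => exact fun _ h => h
  | rot w n θ => exact fun h _ => h
  | const w u => exact fun h _ => h

end TwoQubit

end

theorem mainTheorem9 (L : TwoQubit.ElementaryGateLibrary) :
    ∃ U ∈ Matrix.specialUnitaryGroup (Fin 2 × Fin 2) ℂ,
      (∀ c : TwoQubit.Circuit L,
        (TwoQubit.Circuit.middleOneQubit c).ncard ≤ 2 → ¬ TwoQubit.Circuit.Simulates c U) ∧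
      (∀ c : TwoQubit.Circuit L,
        TwoQubit.Circuit.Simulates c U → 3 ≤ (TwoQubit.Circuit.middleOneParameter c).ncard) := by
  obtain ⟨U, hU, hn⟩ := TwoQubit.exists_not_mem_reachable L
  have hdet := (Matrix.mem_specialUnitaryGroup_iff.1 hU).2
  refine ⟨U, hU, fun c h hc => hn ?_, fun c hc => ?_⟩
  · exact TwoQubit.invariant_mem_reachable hdet hc
      ((TwoQubit.Circuit.ncard_middleOneParameter_le c).trans h)
  · by_contra h
    exact hn (TwoQubit.invariant_mem_reachable hdet hc (by omega))
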